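/- Let $(T,r)$ be a locally compact $\mathbb{R}$-tree, i.e. a locally compact metric space such that (1) for all $u,v\in T$ there is a unique isometric embedding $\phi_{u,v}:[0,r(u,v)]\to T$ with $\phi_{u,v}(0)=u$ and $\phi_{u,v}(r(u,v))=v$, and (2) every injective continuous $\kappa:[0,1]\to T$ satisfies $\kappa([0,1])=\phi_{\kappa(0),\kappa(1)}([0,r(\kappa(0),\kappa(1))])$. Write $[a,b]=\phi_{a,b}([0,r(a,b)])$ and $]a,b[\,=\phi_{a,b}(\,]0,r(a,b)[\,)$, and let $\lambda$ be the length measure of $T$, that is, the trace of one-dimensional Hausdorff measure on the skeleton $T^o=\bigcup_{a,b\in T}]a,b[$ (so $\lambda(]a,b[)=r(a,b)$ and $\lambda(T\setminus T^o)=0$). Let $\nu$ be a Borel measure on $T$ that is finite on compact sets and positive on every open ball. Fix a root $\rho\in T$, and for $x,y\in T$ let $x\wedge y$ be the point with $[\rho,x]\cap[\rho,y]=[\rho,x\wedge y]$. A continuous $f:T\to\mathbb{R}$ is locally absolutely continuous, $f\in\mathcal{A}$, if for all $\varepsilon>0$ and all $S\subseteq T$ with $\lambda(S)<\infty$ there is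 $\delta>0$ such that $\sum_i|f(x_i)-f(y_i)|<\varepsilon$ for all finite families of pairwise disjoint arcs $[x_i,y_i]\subseteq S$ with $\sum_i r(x_i,y_i)<\delta$. For $f\in\mathcal{A}$ the gradient $\nabla f$ is the ($\lambda$-a.e. unique) measurable function $g$, $\lambda$-integrable on every arc, such that for all $x,y\in T$ $$f(y)-f(x)=-\int_{[x\wedge y,x]}g\,d\lambda+\int_{[x\wedge y,y]}g\,d\lambda .$$ Let $\mathcal{C}_0(T)$ be the space of continuous real functions on $T$ with compact support, $\mathcal{C}_\infty(T)$ the space of continuous real functions on $T$ that vanish at infinity, and put $$\mathcal{D}(\mathcal{E})=\{f\in\mathcal{A}:\nabla f\in L^2(\lambda)\}\cap L^2(\nu)\cap\mathcal{C}_\infty(T),\qquad \mathcal{E}(f,g)=\tfrac12\int\nabla f\,\nabla g\,d\lambda,\qquad \mathcal{E}_1(f,g)=\mathcal{E}(f,g)+\int fg\,d\nu .$$ Then the form $(\mathcal{E},\mathcal{D}(\mathcal{E}))$ is regular, i.e. (i) $\mathcal{D}(\mathcal{E})\cap\mathcal{C}_0(T)$ is dense in $\mathcal{D}(\mathcal{E})$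 with respect to the topology generated by $\mathcal{E}_1$: for every $f\in\mathcal{D}(\mathcal{E})$ and $\varepsilon>0$ there is $g\in\mathcal{D}(\mathcal{E})\cap\mathcal{C}_0(T)$ with $\mathcal{E}_1(f-g,f-g)<\varepsilon$; (ii) $\mathcal{D}(\mathcal{E})\cap\mathcal{C}_0(T)$ is dense in $\mathcal{C}_0(T)$ with respect to the uniform topology. -/

import Mathlib

open Set Filter Topology MeasureTheory

namespace RTree

/-- `φ` is a unit speed path (isometric embedding of `[0, r(u,v)]`) from `u` to `v`. -/
structure IsGeodesic {T : Type*} [MetricSpace T] (u v : T) (φ : Icc (0 : ℝ) (dist u v) → T) :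
    Prop where
  isometry : Isometry φ
  source : φ ⟨0, left_mem_Icc.2 dist_nonneg⟩ = u
  target : φ ⟨dist u v, right_mem_Icc.2 dist_nonneg⟩ = v

/-- `ℝ`-trees: metric spaces with unique geodesics and without loops. -/
class IsRealTree (T : Type*) [MetricSpace T] : Prop where
  existsUnique_geodesic : ∀ u v : T, ∃! φ : Icc (0 : ℝ) (dist u v) → T, IsGeodesic u v φ
  loop_free : ∀ κ : Icc (0 : ℝ) 1 → T, Continuous κ → Function.Injective κ →
    ∀ φ : Icc (0 : ℝ) (dist (κ 0) (κ 1)) → T, IsGeodesic (κ 0) (κ 1) φ → range κ = range φ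

section Tree

variable {T : Type*} [MetricSpace T] [IsRealTree T]

/-- The unique unit speed path from `u` to `v`. -/
noncomputable def geodesic (u v : T) : Icc (0 : ℝ) (dist u v) → T :=
  (IsRealTree.existsUnique_geodesic u v).choose

theorem isGeodesic_geodesic (u v : T) : IsGeodesic u v (geodesic u v) :=
  (IsRealTree.existsUnique_geodesic u v).choose_spec.1

theorem IsGeodesic.eq_geodesic {u v : T} {φ : Icc (0 : ℝ) (dist u v) → T}
    (h : IsGeodesic u v φ) : φ = geodesic u v :=
  (IsRealTree.existsUnique_geodesic u v).unique h (isGeodesic_geodesic u v)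

/-- The closed arc `[a,b]`. -/
def arc (a b : T) : Set T := range (geodesic a b)

/-- The open arc `]a,b[`. -/
def openArc (a b : T) : Set T := geodesic a b '' {t | 0 < (t : ℝ) ∧ (t : ℝ) < dist a b}

theorem dist_geodesic_left (a b : T) (s : Icc (0 : ℝ) (dist a b)) :
    dist a (geodesic a b s) = s := by
  have h := (isGeodesic_geodesic a b).isometry.dist_eq ⟨0, left_mem_Icc.2 dist_nonneg⟩ s
  rw [(isGeodesic_geodesic a b).source] at h
  rw [h, Subtype.dist_eq, Real.dist_eq]
  simp [abs_of_nonneg s.2.1]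

theorem geodesic_restrict (a b : T) (s : Icc (0 : ℝ) (dist a b)) (z : T)
    (hz : geodesic a b s = z) (t : ℝ) (ht : t ∈ Icc (0 : ℝ) (dist a z))
    (ht' : t ∈ Icc (0 : ℝ) (dist a b)) : geodesic a z ⟨t, ht⟩ = geodesic a b ⟨t, ht'⟩ := by
  have hd : dist a z = s := by rw [← hz, dist_geodesic_left]
  have hle : dist a z ≤ dist a b := hd ▸ s.2.2
  have hg : IsGeodesic a z
      (fun t : Icc (0 : ℝ) (dist a z) => geodesic a b ⟨t, t.2.1, t.2.2.trans hle⟩) := by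
    refine ⟨?_, (isGeodesic_geodesic a b).source, ?_⟩
    · refine Isometry.of_dist_eq fun x y => ?_
      rw [(isGeodesic_geodesic a b).isometry.dist_eq]
      rfl
    · exact (congrArg (geodesic a b) (Subtype.ext hd)).trans hz
  rw [← hg.eq_geodesic]

theorem mem_arc_iff_of_mem_arc {a b z : T} (hz : z ∈ arc a b) (w : T) :
    w ∈ arc a z ↔ w ∈ arc a b ∧ dist a w ≤ dist a z := by
  obtain ⟨s, hs⟩ := hz
  have hd : dist a z = s := by rw [← hs, dist_geodesic_left]
  constructor
  · rintro ⟨t, rfl⟩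
    have ht' : (t : ℝ) ∈ Icc (0 : ℝ) (dist a b) := ⟨t.2.1, t.2.2.trans (hd ▸ s.2.2)⟩
    refine ⟨⟨⟨t, ht'⟩, ?_⟩, ?_⟩
    · exact (geodesic_restrict a b s z hs t t.2 ht').symm
    · rw [dist_geodesic_left]; exact t.2.2
  · rintro ⟨⟨t, rfl⟩, h⟩
    rw [dist_geodesic_left] at h
    exact ⟨⟨t, t.2.1, h⟩, geodesic_restrict a b s z hs t ⟨t.2.1, h⟩ t.2⟩

theorem right_mem_arc (a b : T) : b ∈ arc a b := ⟨_, (isGeodesic_geodesic a b).target⟩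

theorem eq_of_mem_arc_of_dist_eq {a b z w : T} (hz : z ∈ arc a b) (hw : w ∈ arc a b)
    (h : dist a z = dist a w) : z = w := by
  obtain ⟨s, rfl⟩ := hz
  obtain ⟨t, rfl⟩ := hw
  rw [dist_geodesic_left, dist_geodesic_left] at h
  rw [Subtype.ext h]

theorem isCompact_arc (a b : T) : IsCompact (arc a b) :=
  isCompact_range (isGeodesic_geodesic a b).isometry.continuous

theorem left_mem_arc (a b : T) : a ∈ arc a b := ⟨_, (isGeodesic_geodesic a b).source⟩

/-- Existence and uniqueness of the branch point of `a`, `b`, `x`. -/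
theorem existsUnique_branchPoint (a b x : T) : ∃! c : T, arc a x ∩ arc a b = arc a c := by
  obtain ⟨c, ⟨hcx, hcb⟩, hc⟩ := ((isCompact_arc a x).inter (isCompact_arc a b)).exists_isMaxOn
    ⟨a, left_mem_arc a x, left_mem_arc a b⟩
    (continuous_const.dist continuous_id : Continuous fun z : T => dist a z).continuousOn
  have heq : arc a x ∩ arc a b = arc a c := by
    ext w
    refine ⟨fun hw => (mem_arc_iff_of_mem_arc hcb w).2 ⟨hw.2, hc hw⟩, fun hw => ⟨?_, ?_⟩⟩
    · exact ((mem_arc_iff_of_mem_arc hcx w).1 hw).1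
    · exact ((mem_arc_iff_of_mem_arc hcb w).1 hw).1
  refine ⟨c, heq, fun d hd => ?_⟩
  have hdc : arc a d = arc a c := hd.symm.trans heq
  have h1 : d ∈ arc a c := hdc ▸ right_mem_arc a d
  have h2 : c ∈ arc a d := hdc ▸ right_mem_arc a c
  refine eq_of_mem_arc_of_dist_eq h1 (right_mem_arc a c) (le_antisymm ?_ ?_)
  · exact ((mem_arc_iff_of_mem_arc (right_mem_arc a c) d).1 h1).2
  · exact ((mem_arc_iff_of_mem_arc (right_mem_arc a d) c).1 h2).2

/-- The branch point `c(a,b,x)`: the unique point with `[a,x] ∩ [a,b] = [a,c(a,b,x)]`. -/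
noncomputable def branchPoint (a b x : T) : T := (existsUnique_branchPoint a b x).choose

variable (T) in
/-- The skeleton of the tree: the union of all open arcs. -/
def skeleton : Set T := ⋃ (a : T) (b : T), openArc a b

section Measure

variable [MeasurableSpace T] [BorelSpace T]

variable (T) in
/-- The length measure: the trace of one-dimensional Hausdorff measure on the skeleton. It gives
each open arc `]a,b[` the mass `r(a,b)`, see `lengthMeasure_openArc`, and (when `T` is separable)
it does not charge the complement of the skeleton. -/
noncomputable def lengthMeasure : Measure T := (Measure.hausdorffMeasure 1).restrict (skeleton T)

theorem lengthMeasure_openArc (a b : T) :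
    lengthMeasure T (openArc a b) = ENNReal.ofReal (dist a b) := by
  have hiso := (isGeodesic_geodesic a b).isometry
  have hmeas : MeasurableSet (openArc a b) := by
    have : openArc a b = arc a b \ {a, b} := by
      ext z
      constructor
      · rintro ⟨t, ⟨h0, h1⟩, rfl⟩
        refine ⟨⟨t, rfl⟩, ?_⟩
        rintro (h | h)
        · have := dist_geodesic_left a b t
          rw [h, dist_self] at this
          exact h0.ne this
        · have := dist_geodesic_left a b t
          rw [mem_singleton_iff.1 h] at this
          exact h1.ne this.symm
      · rintro ⟨⟨t, rfl⟩, h⟩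
        refine ⟨t, ⟨lt_of_le_of_ne t.2.1 ?_, lt_of_le_of_ne t.2.2 ?_⟩, rfl⟩
        · intro h0
          refine h (Or.inl ?_)
          rw [← dist_eq_zero, dist_comm, dist_geodesic_left]
          exact h0.symm
        · intro h1
          refine h (Or.inr ?_)
          refine mem_singleton_iff.2 (eq_of_mem_arc_of_dist_eq ⟨t, rfl⟩ (right_mem_arc a b) ?_)
          rw [dist_geodesic_left, h1]
    rw [this]
    exact (isCompact_arc a b).isClosed.measurableSet.diff
      ((measurableSet_singleton b).insert a)
  have hsub : openArc a b ⊆ skeleton T := fun z hz => mem_iUnion₂.2 ⟨a, b, hz⟩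
  rw [lengthMeasure, Measure.restrict_apply hmeas, inter_eq_left.2 hsub, openArc,
    hiso.hausdorffMeasure_image (Or.inl zero_le_one),
    ← isometry_subtype_coe.hausdorffMeasure_image (Or.inl zero_le_one)]
  have himg : (Subtype.val '' {t : Icc (0 : ℝ) (dist a b) | 0 < (t : ℝ) ∧ (t : ℝ) < dist a b})
      = Ioo 0 (dist a b) := by
    ext t
    constructor
    · rintro ⟨s, hs, rfl⟩
      exact hs
    · intro ht
      exact ⟨⟨t, ht.1.le, ht.2.le⟩, ht, rfl⟩
  rw [himg, hausdorffMeasure_real, Real.volume_Ioo, sub_zero]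

/-- The space `𝒜` of locally absolutely continuous functions. -/
def LocallyAbsolutelyContinuous (f : T → ℝ) : Prop :=
  Continuous f ∧ ∀ ε : ℝ, 0 < ε → ∀ S : Set T, lengthMeasure T S < ⊤ →
    ∃ δ : ℝ, 0 < δ ∧ ∀ (n : ℕ) (x y : Fin n → T),
      (∀ i, arc (x i) (y i) ⊆ S) →
      (∀ i j, i ≠ j → Disjoint (arc (x i) (y i)) (arc (x j) (y j))) →
      ∑ i, dist (x i) (y i) < δ → ∑ i, |f (x i) - f (y i)| < ε

/-- The orientation sensitive integral `∫_x^y λ(dz) g(z)` with respect to the root `ρ`, where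
`x ∧ y = c(ρ,x,y)`. -/
noncomputable def orientedIntegral (ρ : T) (g : T → ℝ) (x y : T) : ℝ :=
  -(∫ z in arc (branchPoint ρ x y) x, g z ∂lengthMeasure T)
    + ∫ z in arc (branchPoint ρ x y) y, g z ∂lengthMeasure T

/-- `g` is a version of the gradient of `f` with respect to the root `ρ`: it is integrable on
every arc and `f y - f x = ∫_x^y λ(dz) g(z)` for all `x`, `y`. -/
structure IsGradient (ρ : T) (f g : T → ℝ) : Prop where
  aestronglyMeasurable : AEStronglyMeasurable g (lengthMeasure T)
  integrableOn_arc : ∀ a b : T, IntegrableOn g (arc a b) (lengthMeasure T)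
  sub_eq : ∀ x y : T, f y - f x = orientedIntegral ρ g x y

open Classical in
/-- A version of the gradient of `f` (and `0` if `f` has no gradient); versions agree up to sets
of length zero. -/
noncomputable def gradient (ρ : T) (f : T → ℝ) : T → ℝ :=
  if h : ∃ g, IsGradient ρ f g then h.choose else 0

/-- `ℱ`: locally absolutely continuous functions with gradient in `L²(λ)`. -/
def energySpace (ρ : T) : Set (T → ℝ) :=
  {f | LocallyAbsolutelyContinuous f ∧ (∃ g, IsGradient ρ f g) ∧
    MemLp (gradient ρ f) 2 (lengthMeasure T)}

/-- The domain `𝒟(ℰ) = ℱ ∩ L²(ν) ∩ 𝒞_∞(T)`, where `𝒞_∞(T)` are the continuous functions vanishing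
at infinity. -/
def domain (ρ : T) (ν : Measure T) : Set (T → ℝ) :=
  energySpace ρ ∩ {f | MemLp f 2 ν} ∩ {f | Continuous f ∧ Tendsto f (cocompact T) (𝓝 0)}

/-- The bilinear form `ℰ(f,g) = ½ ∫ ∇f ∇g dλ`. -/
noncomputable def energy (ρ : T) (f g : T → ℝ) : ℝ :=
  (1 / 2) * ∫ z, gradient ρ f z * gradient ρ g z ∂lengthMeasure T

/-- The bilinear form `ℰ_α(f,g) = ℰ(f,g) + α (f,g)_ν`. -/
noncomputable def energyAlpha (ρ : T) (ν : Measure T) (α : ℝ) (f g : T → ℝ) : ℝ :=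
  energy ρ f g + α * ∫ z, f z * g z ∂ν

end Measure

end Tree

/-- `𝒞_0(T)`: continuous functions with compact support. -/
def compactlySupported (T : Type*) [TopologicalSpace T] : Set (T → ℝ) :=
  {f | Continuous f ∧ HasCompactSupport f}

end RTree

/-!
The proof reduces everything to functions of one real variable along geodesics issuing from the
root.

*Geometry.* By uniqueness of geodesics an arc is a metric segment (`mem_arc_iff`), and as there are
no loops the branch point of `ρ, x, y` lies on `[x,y]` (`branchPoint_mem_arc`). A connected, locally
compact metric space is separable, so countably many arcs from the root cover the skeleton
(`exists_seq_skeleton_subset`). As geodesics transport Lebesgue measure to the length measure, a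
property holds `λ`-a.e. as soon as it holds a.e. along each geodesic from the root
(`ae_lengthMeasure_of_ae_curve`). In particular gradients are unique (`IsGradient.ae_eq`), and it
is enough to test them on arcs from the root (`isGradient_iff`).

*Density for the form norm.* For `f` in the domain let `ψ_ε` be truncation to `[-ε, ε]`. Then
`f - ψ_ε ∘ f` vanishes where `|f| ≤ ε`, so it has compact support because `f` vanishes at infinity.
By the chain rule (`IsGradient.clamp`) the gradient of `ψ_ε ∘ f` is `1_{|f| < ε} ∇f`. By dominated
convergence the form norm of `ψ_ε ∘ f` tends to zero, as `∇f = 0` a.e. on `{f = 0}`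
(`tendsto_energyAlpha_clamp`).

*Density for the uniform norm.* A compactly supported continuous function is uniformly close to a
compactly supported Lipschitz function `f` (`exists_lipschitzWith_hasCompactSupport`). A bounded
gradient need not be square integrable, since compact sets may have infinite length. But if `P` is
the projection to the subtree spanned by the root and a finite net of a compact neighbourhood of the
support, then `f ∘ P` is close to `f` and still has compact support, and its gradient is `∇f`
restricted to the subtree, which has finite length (`exists_mem_domain_abs_sub_lt`).
-/

namespace RTree

/-! ### Arcs, geodesics and branch points -/

section Geometry

variable {T : Type*} [MetricSpace T] [IsRealTree T]

/-- The unit speed path from `a` to `b`, extended to all of `ℝ` by stopping it at its endpoints. -/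
noncomputable def curve (a b : T) (t : ℝ) : T :=
  geodesic a b (projIcc 0 (dist a b) dist_nonneg t)

theorem curve_of_mem (a b : T) {t : ℝ} (ht : t ∈ Icc (0 : ℝ) (dist a b)) :
    curve a b t = geodesic a b ⟨t, ht⟩ := by
  rw [curve, projIcc_of_mem _ ht]

theorem lipschitzWith_curve (a b : T) : LipschitzWith 1 (curve a b) := by
  have h := (isGeodesic_geodesic a b).isometry.lipschitz.comp
    (LipschitzWith.projIcc (dist_nonneg : 0 ≤ dist a b))
  rwa [one_mul] at h

theorem continuous_curve (a b : T) : Continuous (curve a b) := (lipschitzWith_curve a b).continuous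

theorem dist_curve (a b : T) {s t : ℝ} (hs : s ∈ Icc (0 : ℝ) (dist a b))
    (ht : t ∈ Icc (0 : ℝ) (dist a b)) : dist (curve a b s) (curve a b t) = |s - t| := by
  rw [curve_of_mem a b hs, curve_of_mem a b ht, (isGeodesic_geodesic a b).isometry.dist_eq]
  rfl

theorem curve_mem_arc (a b : T) (t : ℝ) : curve a b t ∈ arc a b := ⟨_, rfl⟩

@[simp] theorem curve_zero (a b : T) : curve a b 0 = a := by
  rw [curve_of_mem a b ⟨le_rfl, dist_nonneg⟩, (isGeodesic_geodesic a b).source]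

@[simp] theorem curve_dist (a b : T) : curve a b (dist a b) = b := by
  rw [curve_of_mem a b ⟨dist_nonneg, le_rfl⟩, (isGeodesic_geodesic a b).target]

theorem dist_left_curve (a b : T) {t : ℝ} (ht : t ∈ Icc (0 : ℝ) (dist a b)) :
    dist a (curve a b t) = t := by
  rw [curve_of_mem a b ht, dist_geodesic_left]

theorem curve_dist_of_mem_arc {a b z : T} (hz : z ∈ arc a b) : curve a b (dist a z) = z := by
  obtain ⟨t, rfl⟩ := hz
  rw [dist_geodesic_left, curve_of_mem a b t.2]

theorem dist_add_dist_of_mem_arc {a b z : T} (hz : z ∈ arc a b) :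
    dist a z + dist z b = dist a b := by
  have hmem : dist a z ∈ Icc (0 : ℝ) (dist a b) := by
    obtain ⟨t, rfl⟩ := hz
    rw [dist_geodesic_left]; exact t.2
  have h := dist_curve a b hmem (right_mem_Icc.2 dist_nonneg)
  rw [curve_dist_of_mem_arc hz, curve_dist, abs_sub_comm, abs_of_nonneg (sub_nonneg.2 hmem.2)] at h
  linarith

/-- Arcs are metric segments. If the triangle inequality for `a, z, b` is an equality, then the
concatenation of the geodesics from `a` to `z` and from `z` to `b` is an isometric embedding, so it
is the geodesic from `a` to `b`. -/
theorem mem_arc_iff {a b z : T} : z ∈ arc a b ↔ dist a z + dist z b = dist a b := by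
  refine ⟨dist_add_dist_of_mem_arc, fun h => ?_⟩
  let φ : Icc (0 : ℝ) (dist a b) → T := fun t =>
    if (t : ℝ) ≤ dist a z then curve a z t else curve z b (t - dist a z)
  have hle : ∀ s t : ℝ, 0 ≤ s → s ≤ dist a z → dist a z < t → t ≤ dist a b →
      dist (curve a z s) (curve z b (t - dist a z)) = t - s := by
    intro s t hs hsz hzt ht
    have hs' : s ∈ Icc (0 : ℝ) (dist a z) := ⟨hs, hsz⟩
    have ht' : t - dist a z ∈ Icc (0 : ℝ) (dist z b) := ⟨by linarith, by linarith⟩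
    have h1 := dist_left_curve a z hs'
    have h2 := dist_curve a z hs' (right_mem_Icc.2 dist_nonneg)
    have h3 := dist_left_curve z b ht'
    have h4 := dist_curve z b ht' (right_mem_Icc.2 dist_nonneg)
    rw [curve_dist, abs_sub_comm, abs_of_nonneg (by linarith)] at h2 h4
    have h5 := dist_triangle (curve a z s) z (curve z b (t - dist a z))
    have h6 := dist_triangle4 a (curve a z s) (curve z b (t - dist a z)) b
    linarith
  have hφ : IsGeodesic a b φ := by
    refine ⟨Isometry.of_dist_eq fun s t => ?_, ?_, ?_⟩
    · rw [Subtype.dist_eq, Real.dist_eq]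
      simp only [φ]
      split_ifs with hs ht ht
      · exact dist_curve a z ⟨s.2.1, hs⟩ ⟨t.2.1, ht⟩
      · rw [hle s t s.2.1 hs (not_le.1 ht) t.2.2, abs_sub_comm, abs_of_nonneg]
        linarith [not_le.1 ht]
      · rw [dist_comm, hle t s t.2.1 ht (not_le.1 hs) s.2.2, abs_of_nonneg]
        linarith [not_le.1 hs]
      · rw [dist_curve z b ⟨by linarith, by linarith [s.2.2]⟩ ⟨by linarith, by linarith [t.2.2]⟩]
        congr 1; ring
    · simp [φ]
    · by_cases hzb : dist a b ≤ dist a z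
      · have hzb' : z = b := dist_le_zero.1 (by linarith)
        subst hzb'
        simp [φ]
      · simp only [φ, if_neg hzb]
        rw [← h, add_sub_cancel_left, curve_dist]
  have hz : dist a z ∈ Icc (0 : ℝ) (dist a b) :=
    ⟨dist_nonneg, by linarith [dist_nonneg (x := z) (y := b)]⟩
  refine ⟨⟨dist a z, hz⟩, ?_⟩
  rw [← hφ.eq_geodesic]
  simp [φ]

theorem arc_comm (a b : T) : arc a b = arc b a := by
  ext z
  rw [mem_arc_iff, mem_arc_iff, dist_comm a b, dist_comm a z, dist_comm z b, add_comm]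

theorem arc_self (a : T) : arc a a = {a} := by
  ext z
  rw [mem_arc_iff, dist_self, mem_singleton_iff]
  refine ⟨fun h => ?_, fun h => by simp [h]⟩
  have := dist_nonneg (x := a) (y := z)
  exact dist_le_zero.1 (by linarith)

theorem arc_subset_left {a b c : T} (hc : c ∈ arc a b) : arc a c ⊆ arc a b := fun w hw =>
  ((mem_arc_iff_of_mem_arc hc w).1 hw).1

theorem arc_subset_right {a b c : T} (hc : c ∈ arc a b) : arc c b ⊆ arc a b := by
  rw [arc_comm c b, arc_comm a b]
  exact arc_subset_left (arc_comm a b ▸ hc)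

theorem arc_eq_union {a b c : T} (hc : c ∈ arc a b) : arc a b = arc a c ∪ arc c b := by
  refine Subset.antisymm (fun w hw => ?_) (union_subset (arc_subset_left hc) (arc_subset_right hc))
  rcases le_total (dist a w) (dist a c) with h | h
  · exact Or.inl ((mem_arc_iff_of_mem_arc hc w).2 ⟨hw, h⟩)
  · right
    rw [arc_comm]
    rw [arc_comm] at hc hw
    refine (mem_arc_iff_of_mem_arc hc w).2 ⟨hw, ?_⟩
    have h1 := mem_arc_iff.1 hc
    have h2 := mem_arc_iff.1 hw
    rw [dist_comm a w, dist_comm a c] at h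
    linarith

theorem eq_of_mem_arc_of_mem_arc {a b c w : T} (hc : c ∈ arc a b) (h1 : w ∈ arc a c)
    (h2 : w ∈ arc c b) : w = c := by
  rw [mem_arc_iff] at hc h1 h2
  have h3 := dist_triangle a w b
  refine dist_le_zero.1 ?_
  have h4 := dist_comm w c
  linarith

/-- A path made of two arcs that only meet at their common endpoint is injective, so it is an arc
since the tree has no loops. -/
theorem mem_arc_of_inter_subset {a b c : T} (h : arc a c ∩ arc c b ⊆ {c}) : c ∈ arc a b := by
  rcases eq_or_ne a c with rfl | hac
  · exact left_mem_arc _ _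
  rcases eq_or_ne c b with rfl | hcb
  · exact right_mem_arc _ _
  have hac' := dist_pos.2 hac
  have hcb' := dist_pos.2 hcb
  let κ : Icc (0 : ℝ) 1 → T := fun t =>
    if (t : ℝ) ≤ 1 / 2 then curve a c (2 * t * dist a c) else curve c b ((2 * t - 1) * dist c b)
  have hκc : Continuous κ := by
    refine Continuous.if_le ?_ ?_ continuous_subtype_val continuous_const ?_
    · exact (continuous_curve a c).comp (by fun_prop)
    · exact (continuous_curve c b).comp (by fun_prop)
    · intro t ht
      rw [ht]
      norm_num
  have hmem1 : ∀ t : Icc (0 : ℝ) 1, (t : ℝ) ≤ 1 / 2 →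
      2 * t * dist a c ∈ Icc (0 : ℝ) (dist a c) := fun t ht =>
    ⟨by have := t.2.1; positivity, by nlinarith [t.2.1]⟩
  have hmem2 : ∀ t : Icc (0 : ℝ) 1, ¬ (t : ℝ) ≤ 1 / 2 →
      (2 * t - 1) * dist c b ∈ Icc (0 : ℝ) (dist c b) := fun t ht =>
    ⟨mul_nonneg (by linarith) hcb'.le, by nlinarith [t.2.2]⟩
  have hmix : ∀ s t : Icc (0 : ℝ) 1, (s : ℝ) ≤ 1 / 2 → ¬ (t : ℝ) ≤ 1 / 2 →
      curve a c (2 * s * dist a c) ≠ curve c b ((2 * t - 1) * dist c b) := by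
    intro s t hs ht heq
    have hc : curve a c (2 * s * dist a c) = c :=
      h ⟨curve_mem_arc _ _ _, heq ▸ curve_mem_arc _ _ _⟩
    have h1 := dist_left_curve c b (hmem2 t ht)
    rw [← heq, hc, dist_self] at h1
    nlinarith [not_le.1 ht]
  have hκi : Function.Injective κ := by
    intro s t hst
    simp only [κ] at hst
    split_ifs at hst with hs ht ht
    · have h1 := dist_left_curve a c (hmem1 s hs)
      rw [hst, dist_left_curve a c (hmem1 t ht)] at h1
      have := mul_right_cancel₀ hac'.ne' h1
      exact Subtype.ext (by linarith)
    · exact absurd hst (hmix s t hs ht)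
    · exact absurd hst.symm (hmix t s ht hs)
    · have h1 := dist_left_curve c b (hmem2 s hs)
      rw [hst, dist_left_curve c b (hmem2 t ht)] at h1
      have := mul_right_cancel₀ hcb'.ne' h1
      exact Subtype.ext (by linarith)
  have hr : range κ = arc (κ 0) (κ 1) :=
    IsRealTree.loop_free κ hκc hκi _ (isGeodesic_geodesic _ _)
  have h0 : κ 0 = a := by simp [κ]
  have h1 : κ 1 = b := by norm_num [κ]
  rw [h0, h1] at hr
  rw [← hr]
  exact ⟨⟨1 / 2, by norm_num, by norm_num⟩, by simp [κ]⟩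

theorem arc_inter_arc (a b x : T) : arc a x ∩ arc a b = arc a (branchPoint a b x) :=
  (existsUnique_branchPoint a b x).choose_spec.1

theorem branchPoint_mem_left (a b x : T) : branchPoint a b x ∈ arc a b :=
  ((arc_inter_arc a b x).symm ▸ right_mem_arc a _ : branchPoint a b x ∈ arc a x ∩ arc a b).2

theorem branchPoint_mem_right (a b x : T) : branchPoint a b x ∈ arc a x :=
  ((arc_inter_arc a b x).symm ▸ right_mem_arc a _ : branchPoint a b x ∈ arc a x ∩ arc a b).1

theorem branchPoint_mem_arc (a b x : T) : branchPoint a b x ∈ arc b x := by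
  have hb := branchPoint_mem_left a b x
  have hx := branchPoint_mem_right a b x
  refine mem_arc_of_inter_subset ?_
  rintro w ⟨hwb, hwx⟩
  rw [arc_comm] at hwb
  have hw : w ∈ arc a (branchPoint a b x) :=
    arc_inter_arc a b x ▸ ⟨arc_subset_right hx hwx, arc_subset_right hb hwb⟩
  exact eq_of_mem_arc_of_mem_arc hx hw hwx

theorem arc_subset_union (a b c : T) : arc a b ⊆ arc c a ∪ arc c b := by
  rw [arc_eq_union (branchPoint_mem_arc c a b), arc_comm a]
  exact union_subset_union (arc_subset_right (branchPoint_mem_left c a b))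
    (arc_subset_right (branchPoint_mem_right c a b))

/-- Geodesics from `a` to a point of `[a,b]` are initial pieces of the geodesic from `a` to `b`. -/
theorem curve_eq_of_mem_arc {a b z : T} (hz : z ∈ arc a b) {s : ℝ} (hs : s ≤ dist a z) :
    curve a z s = curve a b s := by
  rcases le_total 0 s with h0 | h0
  · obtain ⟨t, ht⟩ := hz
    have hd : dist a z = t := by rw [← ht, dist_geodesic_left]
    have hs' : s ∈ Icc (0 : ℝ) (dist a b) := ⟨h0, hs.trans (hd ▸ t.2.2)⟩
    rw [curve_of_mem a z ⟨h0, hs⟩, curve_of_mem a b hs']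
    exact geodesic_restrict a b t z ht s ⟨h0, hs⟩ hs'
  · rw [curve, curve, projIcc_of_le_left _ h0, projIcc_of_le_left _ h0]
    exact (isGeodesic_geodesic a z).source.trans (isGeodesic_geodesic a b).source.symm

theorem isPreconnected_univ : IsPreconnected (univ : Set T) := by
  refine isPreconnected_of_forall_pair fun a _ b _ => ⟨arc a b, subset_univ _, left_mem_arc a b,
    right_mem_arc a b, ?_⟩
  have : PreconnectedSpace (Icc (0 : ℝ) (dist a b)) :=
    Subtype.preconnectedSpace isPreconnected_Icc
  exact isPreconnected_range (isGeodesic_geodesic a b).isometry.continuous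

/-- The arcs from `ρ` to the points of a dense set cover the skeleton: a point `z` of `]a,b[` lies
on the arc from `ρ` to `a` or to `b`, hence also on the arcs from `ρ` to all points near that
endpoint. -/
theorem skeleton_subset_iUnion_arc {ρ : T} {D : Set T} (hD : Dense D) :
    skeleton T ⊆ ⋃ d ∈ D, arc ρ d := by
  have key : ∀ a z : T, z ∈ arc ρ a → z ≠ a → z ∈ ⋃ d ∈ D, arc ρ d := by
    intro a z hz hza
    obtain ⟨d, hd, hdD⟩ := hD.exists_dist_lt a (dist_pos.2 hza)
    refine mem_iUnion₂.2 ⟨d, hd, ?_⟩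
    rcases arc_subset_union ρ a d hz with h | h
    · exact arc_comm d ρ ▸ h
    · have := mem_arc_iff.1 h
      rw [dist_comm d a] at this
      linarith [dist_nonneg (x := d) (y := z)]
  intro z hz
  obtain ⟨a, b, t, ⟨h0, h1⟩, rfl⟩ := mem_iUnion₂.1 hz
  have hd := dist_geodesic_left a b t
  rcases arc_subset_union a b ρ ⟨t, rfl⟩ with h | h
  · refine key a _ h fun he => ?_
    rw [he, dist_self] at hd
    exact h0.ne hd
  · refine key b _ h fun he => ?_
    rw [he] at hd
    exact h1.ne hd.symm

end Geometry

/-! ### Separability -/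

section Separability

/-- A connected, locally compact metric space is separable. Start from a point and repeatedly add
the half-size concentric balls of all separable balls centred at points already reached: each step
preserves separability, and the set reached in the end is open and closed. -/
theorem separableSpace_of_isPreconnected {X : Type*} [MetricSpace X] [LocallyCompactSpace X]
    (hX : IsPreconnected (univ : Set X)) : TopologicalSpace.SeparableSpace X := by
  rw [← TopologicalSpace.isSeparable_univ_iff]
  rcases isEmpty_or_nonempty X with hE | ⟨⟨x₀⟩⟩
  · rw [univ_eq_empty_iff.2 hE]
    exact finite_empty.isSeparable
  have hball : ∀ x : X, ∃ s : ℝ, 0 < s ∧ TopologicalSpace.IsSeparable (Metric.closedBall x s) := by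
    intro x
    obtain ⟨s, hs, hc⟩ := (isCompact_singleton (x := x)).exists_isCompact_cthickening
    rw [Metric.cthickening_singleton x hs.le] at hc
    exact ⟨s, hs, hc.isSeparable⟩
  let B : Set X → Set X := fun A =>
    {y | ∃ x ∈ A, ∃ s : ℝ, TopologicalSpace.IsSeparable (Metric.closedBall x s) ∧ dist x y < s / 2}
  have hB : ∀ A, TopologicalSpace.IsSeparable A → TopologicalSpace.IsSeparable (B A) := by
    rintro A ⟨D, hDc, hD⟩
    let J : Set (X × ℚ) :=
      {p | p.1 ∈ D ∧ TopologicalSpace.IsSeparable (Metric.closedBall p.1 (p.2 : ℝ))}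
    have hJ : J.Countable :=
      Countable.mono (fun p hp => mem_prod.2 ⟨hp.1, mem_univ p.2⟩)
        (hDc.prod (countable_univ (α := ℚ)))
    have hU : TopologicalSpace.IsSeparable (⋃ p ∈ J, Metric.closedBall p.1 (p.2 : ℝ)) := by
      have := hJ.to_subtype
      rw [biUnion_eq_iUnion]
      exact TopologicalSpace.IsSeparable.iUnion fun p => p.2.2
    refine hU.mono ?_
    rintro y ⟨x, hx, s, hs, hxy⟩
    have hs0 : 0 < s := by linarith [dist_nonneg (x := x) (y := y)]
    obtain ⟨d, hd, hxd⟩ := Metric.mem_closure_iff.1 (hD hx) (s / 8) (by linarith)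
    obtain ⟨q, hq1, hq2⟩ := exists_rat_btwn (show s * (5 / 8) < s * (7 / 8) by linarith)
    have hdx := dist_comm d x
    refine mem_iUnion₂.2 ⟨(d, q), ⟨hd, hs.mono ?_⟩, ?_⟩
    · exact Metric.closedBall_subset_closedBall' (by simp only; linarith)
    · have h1 := dist_triangle d x y
      rw [Metric.mem_closedBall, dist_comm]
      simp only
      linarith
  let A : ℕ → Set X := fun n => B^[n] {x₀}
  have hA : ∀ n, A (n + 1) = B (A n) := fun n => Function.iterate_succ_apply' B n _
  have hsep : ∀ n, TopologicalSpace.IsSeparable (A n) := by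
    intro n
    induction n with
    | zero => exact (finite_singleton x₀).isSeparable
    | succ n ih => rw [hA]; exact hB _ ih
  have hopen : IsOpen (⋃ n, A n) := by
    rw [Metric.isOpen_iff]
    intro y hy
    obtain ⟨n, hn⟩ := mem_iUnion.1 hy
    obtain ⟨s, hs, hsy⟩ := hball y
    refine ⟨s / 2, by linarith, fun z hz => mem_iUnion.2 ⟨n + 1, ?_⟩⟩
    rw [hA]
    exact ⟨y, hn, s, hsy, by rw [dist_comm]; exact hz⟩
  have hclosed : IsClosed (⋃ n, A n) := by
    refine isClosed_of_closure_subset fun y hy => ?_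
    obtain ⟨s, hs, hsy⟩ := hball y
    obtain ⟨x, hx, hyx⟩ := Metric.mem_closure_iff.1 hy (s / 4) (by linarith)
    obtain ⟨n, hn⟩ := mem_iUnion.1 hx
    have hxy := dist_comm x y
    refine mem_iUnion.2 ⟨n + 1, ?_⟩
    rw [hA]
    refine ⟨x, hn, s * (3 / 4), hsy.mono ?_, by linarith⟩
    exact Metric.closedBall_subset_closedBall' (by linarith)
  have := preconnectedSpace_iff_univ.2 hX
  rw [← IsClopen.eq_univ ⟨hclosed, hopen⟩ ⟨x₀, mem_iUnion.2 ⟨0, rfl⟩⟩]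
  exact TopologicalSpace.IsSeparable.iUnion hsep

end Separability

/-! ### Covering the skeleton by countably many arcs -/

section Separable

variable {T : Type*} [MetricSpace T] [IsRealTree T]

theorem curve_comp_val (a b : T) :
    curve a b ∘ (Subtype.val : Icc 0 (dist a b) → ℝ) = geodesic a b :=
  funext fun t => curve_of_mem a b t.2

theorem mem_openArc {a b z : T} (hz : z ∈ arc a b) (ha : z ≠ a) (hb : z ≠ b) :
    z ∈ openArc a b := by
  have hab := mem_arc_iff.1 hz
  have hzb := dist_pos.2 hb
  have hd : dist a z ∈ Icc (0 : ℝ) (dist a b) := ⟨dist_nonneg, by linarith⟩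
  have hlt : dist a z < dist a b := by linarith
  exact ⟨⟨dist a z, hd⟩, ⟨dist_pos.2 ha.symm, hlt⟩,
    (curve_of_mem a b hd).symm.trans (curve_dist_of_mem_arc hz)⟩

/-- Locally compact trees are separable, so that countably many arcs issuing from the root carry
the length measure. -/
theorem exists_seq_skeleton_subset [LocallyCompactSpace T] (ρ : T) :
    ∃ u : ℕ → T, skeleton T ⊆ ⋃ n, arc ρ (u n) := by
  have : TopologicalSpace.SeparableSpace T := separableSpace_of_isPreconnected isPreconnected_univ
  have : Nonempty T := ⟨ρ⟩
  refine ⟨TopologicalSpace.denseSeq T, ?_⟩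
  have h := skeleton_subset_iUnion_arc (ρ := ρ) (TopologicalSpace.denseRange_denseSeq T)
  rwa [biUnion_range] at h

end Separable

/-! ### The length measure and gradients along geodesics -/

section LengthMeasure

theorem ae_eq_of_forall_intervalIntegral_eq {d : ℝ} {G₁ G₂ : ℝ → ℝ}
    (h₁ : IntervalIntegrable G₁ volume 0 d) (h₂ : IntervalIntegrable G₂ volume 0 d)
    (h : ∀ t ∈ Icc 0 d, ∫ s in (0)..t, G₁ s = ∫ s in (0)..t, G₂ s) :
    ∀ᵐ s, s ∈ Icc 0 d → G₁ s = G₂ s := by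
  have hne : ∀ c : ℝ, ∀ᵐ s : ℝ, s ≠ c := fun c => by simp [ae_iff, measure_singleton]
  filter_upwards [h₁.ae_hasDerivAt_integral, h₂.ae_hasDerivAt_integral, hne 0, hne d]
    with s hs₁ hs₂ hs0 hsd hs
  have hd : (0 : ℝ) ≤ d := hs.1.trans hs.2
  rw [uIcc_of_le hd] at hs₁ hs₂
  refine (hs₁ hs 0 ⟨le_rfl, hd⟩).unique ((hs₂ hs 0 ⟨le_rfl, hd⟩).congr_of_eventuallyEq ?_)
  filter_upwards [Icc_mem_nhds (lt_of_le_of_ne hs.1 hs0.symm) (lt_of_le_of_ne hs.2 hsd)]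
    with t ht using h t ht

variable {T : Type*} [MetricSpace T] [IsRealTree T] [MeasurableSpace T] [BorelSpace T]

theorem measurableSet_arc (a b : T) : MeasurableSet (arc a b) :=
  (isCompact_arc a b).isClosed.measurableSet

theorem lengthMeasure_singleton (x : T) : lengthMeasure T {x} = 0 := by
  have := Measure.nullSingletonClass_hausdorff T one_pos
  exact le_antisymm ((Measure.restrict_apply_le _ _).trans (measure_singleton x).le) bot_le

theorem map_geodesic (a b : T) :
    (Measure.hausdorffMeasure 1).map (geodesic a b) = (lengthMeasure T).restrict (arc a b) := by
  have hskel : (arc a b ∩ skeleton T : Set T) =ᵐ[Measure.hausdorffMeasure 1] arc a b := by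
    have := Measure.nullSingletonClass_hausdorff T one_pos
    refine inter_subset_left.eventuallyLE.antisymm (ae_le_set.2 ?_)
    refine measure_mono_null (t := {a, b}) (fun z hz => ?_) ((toFinite _).measure_zero _)
    by_contra hne
    rw [mem_insert_iff, mem_singleton_iff, not_or] at hne
    exact hz.2 ⟨hz.1, mem_iUnion₂.2 ⟨a, b, mem_openArc hz.1 hne.1 hne.2⟩⟩
  rw [(isGeodesic_geodesic a b).isometry.map_hausdorffMeasure (Or.inl zero_le_one), lengthMeasure,
    Measure.restrict_restrict (measurableSet_arc a b), Measure.restrict_congr_set hskel, arc]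

theorem map_subtype_val_hausdorffMeasure (s : Set ℝ) :
    (Measure.hausdorffMeasure 1 : Measure s).map Subtype.val = volume.restrict s := by
  rw [isometry_subtype_coe.map_hausdorffMeasure (Or.inl zero_le_one), Subtype.range_coe,
    hausdorffMeasure_real]

/-- The geodesic from `a` to `b` transports Lebesgue measure to the length measure on `[a,b]`. -/
theorem map_curve_volume (a b : T) :
    (volume.restrict (Icc 0 (dist a b))).map (curve a b) =
      (lengthMeasure T).restrict (arc a b) := by
  rw [← map_subtype_val_hausdorffMeasure,
    Measure.map_map (continuous_curve a b).measurable measurable_subtype_coe, curve_comp_val,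
    map_geodesic]

theorem ae_restrict_arc_iff (a b : T) {p : T → Prop} :
    (∀ᵐ z ∂(lengthMeasure T).restrict (arc a b), p z) ↔
      ∀ᵐ s, s ∈ Icc (0 : ℝ) (dist a b) → p (curve a b s) := by
  have hgeo := (isGeodesic_geodesic a b).isometry.isClosedEmbedding.measurableEmbedding
  rw [← map_geodesic, hgeo.ae_map_iff, ← ae_restrict_iff' measurableSet_Icc,
    ← map_subtype_val_hausdorffMeasure,
    (MeasurableEmbedding.subtype_coe measurableSet_Icc).ae_map_iff]
  exact eventually_congr (Eventually.of_forall fun t => by rw [curve_of_mem a b t.2])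

theorem lengthMeasure_arc (a b : T) : lengthMeasure T (arc a b) = ENNReal.ofReal (dist a b) := by
  rw [← Measure.restrict_apply_univ, ← map_curve_volume,
    Measure.map_apply (continuous_curve a b).measurable MeasurableSet.univ, preimage_univ,
    Measure.restrict_apply_univ, Real.volume_Icc, sub_zero]

theorem integrableOn_arc_iff {g : T → ℝ} (hg : AEStronglyMeasurable g (lengthMeasure T))
    (a b : T) : IntegrableOn g (arc a b) (lengthMeasure T) ↔
      IntervalIntegrable (fun s => g (curve a b s)) volume 0 (dist a b) := by
  rw [IntegrableOn, ← map_curve_volume, integrable_map_measure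
    (by rw [map_curve_volume]; exact hg.restrict) (continuous_curve a b).measurable.aemeasurable,
    intervalIntegrable_iff_integrableOn_Icc_of_le dist_nonneg]
  rfl

theorem setIntegral_arc {g : T → ℝ} (hg : AEStronglyMeasurable g (lengthMeasure T)) (a b : T) :
    ∫ z in arc a b, g z ∂lengthMeasure T = ∫ s in (0)..(dist a b), g (curve a b s) := by
  rw [← map_curve_volume, integral_map (continuous_curve a b).measurable.aemeasurable
    (by rw [map_curve_volume]; exact hg.restrict),
    intervalIntegral.integral_of_le dist_nonneg, integral_Icc_eq_integral_Ioc]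

theorem setIntegral_arc_curve {g : T → ℝ} (hg : AEStronglyMeasurable g (lengthMeasure T)) (a b : T)
    {t : ℝ} (ht : t ∈ Icc (0 : ℝ) (dist a b)) :
    ∫ z in arc a (curve a b t), g z ∂lengthMeasure T = ∫ s in (0)..t, g (curve a b s) := by
  rw [setIntegral_arc hg, dist_left_curve a b ht]
  refine intervalIntegral.integral_congr fun s hs => ?_
  rw [uIcc_of_le ht.1] at hs
  rw [curve_eq_of_mem_arc (curve_mem_arc a b t) ((dist_left_curve a b ht).symm ▸ hs.2)]

theorem setIntegral_arc_add {g : T → ℝ} {a b c : T} (hc : c ∈ arc a b)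
    (hg : IntegrableOn g (arc a b) (lengthMeasure T)) :
    ∫ z in arc a b, g z ∂lengthMeasure T =
      ∫ z in arc a c, g z ∂lengthMeasure T + ∫ z in arc c b, g z ∂lengthMeasure T := by
  rw [arc_eq_union hc, setIntegral_union₀ ?_ (measurableSet_arc c b).nullMeasurableSet
    (hg.mono_set (arc_subset_left hc)) (hg.mono_set (arc_subset_right hc))]
  exact measure_mono_null (fun w hw => eq_of_mem_arc_of_mem_arc hc hw.1 hw.2)
    (lengthMeasure_singleton c)

theorem orientedIntegral_eq_sub {ρ : T} {g : T → ℝ}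
    (hg : ∀ x, IntegrableOn g (arc ρ x) (lengthMeasure T)) (x y : T) :
    orientedIntegral ρ g x y =
      ∫ z in arc ρ y, g z ∂lengthMeasure T - ∫ z in arc ρ x, g z ∂lengthMeasure T := by
  rw [setIntegral_arc_add (branchPoint_mem_left ρ x y) (hg x),
    setIntegral_arc_add (branchPoint_mem_right ρ x y) (hg y), orientedIntegral]
  ring

/-- Gradients can be tested on arcs issuing from the root. -/
theorem isGradient_iff {ρ : T} {f g : T → ℝ} :
    IsGradient ρ f g ↔ AEStronglyMeasurable g (lengthMeasure T) ∧
      (∀ x, IntegrableOn g (arc ρ x) (lengthMeasure T)) ∧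
      ∀ x, f x - f ρ = ∫ z in arc ρ x, g z ∂lengthMeasure T := by
  constructor
  · intro h
    refine ⟨h.aestronglyMeasurable, h.integrableOn_arc ρ, fun x => ?_⟩
    rw [h.sub_eq ρ x, orientedIntegral_eq_sub (h.integrableOn_arc ρ), arc_self,
      Measure.restrict_zero_set (lengthMeasure_singleton ρ), integral_zero_measure, sub_zero]
  · rintro ⟨hm, hi, h⟩
    refine ⟨hm, fun a b => ((hi a).union (hi b)).mono_set (arc_subset_union a b ρ), fun x y => ?_⟩
    rw [orientedIntegral_eq_sub hi, ← h x, ← h y]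
    ring

theorem IsGradient.apply_curve {ρ : T} {f g : T → ℝ} (h : IsGradient ρ f g) (y : T) {t : ℝ}
    (ht : t ∈ Icc (0 : ℝ) (dist ρ y)) :
    f (curve ρ y t) = f ρ + ∫ s in (0)..t, g (curve ρ y s) := by
  rw [← setIntegral_arc_curve h.aestronglyMeasurable ρ y ht,
    ← (isGradient_iff.1 h).2.2 (curve ρ y t), add_sub_cancel]

theorem IsGradient.sub {ρ : T} {f₁ f₂ g₁ g₂ : T → ℝ} (h₁ : IsGradient ρ f₁ g₁)
    (h₂ : IsGradient ρ f₂ g₂) : IsGradient ρ (f₁ - f₂) (g₁ - g₂) := by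
  rw [isGradient_iff] at *
  refine ⟨h₁.1.sub h₂.1, fun x => (h₁.2.1 x).sub (h₂.2.1 x), fun x => ?_⟩
  simp only [Pi.sub_apply]
  rw [integral_sub (h₁.2.1 x) (h₂.2.1 x), ← h₁.2.2, ← h₂.2.2]
  ring

theorem lengthMeasure_restrict_iUnion_arc {ρ : T} {u : ℕ → T}
    (hu : skeleton T ⊆ ⋃ n, arc ρ (u n)) :
    (lengthMeasure T).restrict (⋃ n, arc ρ (u n)) = lengthMeasure T := by
  rw [lengthMeasure,
    Measure.restrict_restrict (MeasurableSet.iUnion fun n => measurableSet_arc _ _),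
    inter_eq_right.2 hu]

variable [LocallyCompactSpace T]

/-- Properties holding almost everywhere along every geodesic from the root hold almost everywhere
for the length measure. -/
theorem ae_lengthMeasure_of_ae_curve (ρ : T) {p : T → Prop}
    (h : ∀ y, ∀ᵐ s, s ∈ Icc (0 : ℝ) (dist ρ y) → p (curve ρ y s)) :
    ∀ᵐ z ∂lengthMeasure T, p z := by
  obtain ⟨u, hu⟩ := exists_seq_skeleton_subset ρ
  rw [← lengthMeasure_restrict_iUnion_arc hu]
  exact (ae_restrict_iUnion_iff _ _).2 fun n => (ae_restrict_arc_iff ρ (u n)).2 (h (u n))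

/-- The gradient is unique up to sets of length zero. -/
theorem IsGradient.ae_eq {ρ : T} {f g₁ g₂ : T → ℝ} (h₁ : IsGradient ρ f g₁)
    (h₂ : IsGradient ρ f g₂) : g₁ =ᵐ[lengthMeasure T] g₂ := by
  refine ae_lengthMeasure_of_ae_curve ρ fun y => ?_
  filter_upwards [ae_eq_of_forall_intervalIntegral_eq
    ((integrableOn_arc_iff h₁.aestronglyMeasurable ρ y).1 (h₁.integrableOn_arc ρ y))
    ((integrableOn_arc_iff h₂.aestronglyMeasurable ρ y).1 (h₂.integrableOn_arc ρ y))
    fun t ht => add_left_cancel ((h₁.apply_curve y ht).symm.trans (h₂.apply_curve y ht))]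
    with s hs using hs

theorem gradient_ae_eq {ρ : T} {f g : T → ℝ} (h : IsGradient ρ f g) :
    gradient ρ f =ᵐ[lengthMeasure T] g := by
  have hex : ∃ g, IsGradient ρ f g := ⟨g, h⟩
  rw [gradient, dif_pos hex]
  exact hex.choose_spec.ae_eq h

end LengthMeasure

/-! ### Truncation of functions on the real line -/

section RealLine

/-- The truncation of `x` to the interval `[-ε, ε]`. -/
def clamp (ε x : ℝ) : ℝ := max (-ε) (min x ε)

theorem lipschitzWith_clamp (ε : ℝ) : LipschitzWith 1 (clamp ε) :=
  (LipschitzWith.id.min_const ε).const_max (-ε)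

theorem clamp_of_abs_le {ε x : ℝ} (h : |x| ≤ ε) : clamp ε x = x := by
  rw [abs_le] at h
  rw [clamp, min_eq_left h.2, max_eq_right h.1]

theorem abs_clamp_le {ε : ℝ} (hε : 0 ≤ ε) (x : ℝ) : |clamp ε x| ≤ ε :=
  abs_le.2 ⟨le_max_left _ _, max_le (by linarith) (min_le_right _ _)⟩

theorem abs_clamp_le_abs {ε : ℝ} (hε : 0 ≤ ε) (x : ℝ) : |clamp ε x| ≤ |x| := by
  have h := (lipschitzWith_clamp ε).dist_le_mul x 0
  rwa [clamp_of_abs_le (x := 0) (by simpa), Real.dist_eq, Real.dist_eq, sub_zero, sub_zero,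
    NNReal.coe_one, one_mul] at h

theorem abs_sub_clamp_le_abs {ε : ℝ} (hε : 0 ≤ ε) (x : ℝ) : |x - clamp ε x| ≤ |x| := by
  rcases le_total |x| ε with h | h
  · simp [clamp_of_abs_le h]
  · rcases le_total 0 x with hx | hx
    · rw [abs_of_nonneg hx] at *
      rw [clamp, min_eq_right h, max_eq_right (by linarith), abs_of_nonneg] <;> linarith
    · rw [abs_of_nonpos hx] at *
      rw [clamp, min_eq_left (by linarith), max_eq_left (by linarith), abs_of_nonpos] <;> linarith

theorem abs_sub_clamp_sub_le (ε x y : ℝ) :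
    |(x - clamp ε x) - (y - clamp ε y)| ≤ 2 * |x - y| := by
  have h := (lipschitzWith_clamp ε).dist_le_mul x y
  rw [Real.dist_eq, Real.dist_eq, NNReal.coe_one, one_mul] at h
  calc |(x - clamp ε x) - (y - clamp ε y)| = |(x - y) - (clamp ε x - clamp ε y)| := by congr 1; ring
    _ ≤ |x - y| + |clamp ε x - clamp ε y| := abs_sub _ _
    _ ≤ 2 * |x - y| := by linarith

theorem countable_level_deriv_ne_zero (F G : ℝ → ℝ) (c : ℝ) :
    {s | F s = c ∧ HasDerivAt F (G s) s ∧ G s ≠ 0}.Countable := by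
  refine (countable_setOfPred_isolated_right_within (s := {s | F s = c})).mono ?_
  rintro s ⟨hs, hd, h0⟩
  refine ⟨hs, ?_⟩
  have h := hd.eventually_ne h0 (c := c)
  rw [← empty_mem_iff_bot]
  have h' : ∀ᶠ z in 𝓝[{s | F s = c} ∩ Ioi s] s, F z ≠ c :=
    h.filter_mono (nhdsWithin_mono _ fun z hz => ne_of_gt hz.2)
  filter_upwards [h', self_mem_nhdsWithin] with z hz hz'
  exact hz hz'.1

/-- The derivative of a function vanishes almost everywhere on each of its level sets, as the points
of a level set with nonzero derivative are isolated. -/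
theorem ae_eq_zero_of_level {F G : ℝ → ℝ} {s : Set ℝ}
    (h : ∀ᵐ x, x ∈ s → HasDerivAt F (G x) x) (c : ℝ) : ∀ᵐ x, x ∈ s → F x = c → G x = 0 := by
  filter_upwards [h, (countable_level_deriv_ne_zero F G c).ae_notMem volume] with x hx hx' hs hc
  by_contra h0
  exact hx' ⟨hc, hx hs, h0⟩

theorem hasDerivAt_zero_comp {F φ : ℝ → ℝ} (hφ : LipschitzWith 1 φ) {s : ℝ}
    (h : HasDerivAt F 0 s) : HasDerivAt (fun t => φ (F t)) 0 s := by
  rw [hasDerivAt_iff_isLittleO] at *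
  simp only [smul_zero, sub_zero] at *
  refine Asymptotics.IsBigO.trans_isLittleO (.of_bound 1 (.of_forall fun t => ?_)) h
  simpa [Real.dist_eq] using hφ.dist_le_mul (F t) (F s)

theorem absolutelyContinuousOnInterval_comp {F φ : ℝ → ℝ} (hφ : LipschitzWith 1 φ) {a b : ℝ}
    (h : AbsolutelyContinuousOnInterval F a b) :
    AbsolutelyContinuousOnInterval (fun t => φ (F t)) a b := by
  rw [absolutelyContinuousOnInterval_iff] at *
  intro ε hε
  obtain ⟨δ, hδ, hF⟩ := h ε hε
  refine ⟨δ, hδ, fun E hE hs => lt_of_le_of_lt (Finset.sum_le_sum fun i _ => ?_) (hF E hE hs)⟩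
  simpa using hφ.dist_le_mul (F (E.2 i).1) (F (E.2 i).2)

theorem ae_hasDerivAt_add_integral {G : ℝ → ℝ} {d : ℝ} (hd : 0 ≤ d)
    (hG : IntervalIntegrable G volume 0 d) (c : ℝ) :
    ∀ᵐ s, s ∈ Icc 0 d → HasDerivAt (fun t => c + ∫ r in (0)..t, G r) (G s) s := by
  filter_upwards [hG.ae_hasDerivAt_integral] with s hs hsd
  rw [uIcc_of_le hd] at hs
  exact (hs hsd 0 ⟨le_rfl, hd⟩).const_add c

/-- Chain rule for truncation. The corner values `±ε` do not matter, since the derivative vanishes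
almost everywhere on the corresponding level sets. -/
theorem clamp_add_integral {G F : ℝ → ℝ} {d : ℝ} (hd : 0 ≤ d)
    (hG : IntervalIntegrable G volume 0 d) (c ε : ℝ)
    (hF : ∀ t, F t = c + ∫ r in (0)..t, G r) :
    clamp ε (F d) - clamp ε (F 0) = ∫ s in (0)..d, {s | |F s| < ε}.indicator G s := by
  have hF' : F = fun t => c + ∫ r in (0)..t, G r := funext hF
  have hae : ∀ᵐ s, s ∈ Icc 0 d → HasDerivAt F (G s) s := hF' ▸ ae_hasDerivAt_add_integral hd hG c
  have hac : AbsolutelyContinuousOnInterval F 0 d := by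
    rw [hF']
    exact (LipschitzWith.const c).lipschitzOnWith.absolutelyContinuousOnInterval.add
      (hG.absolutelyContinuousOnInterval_intervalIntegral left_mem_uIcc)
  rw [← (absolutelyContinuousOnInterval_comp (lipschitzWith_clamp ε)
    hac).integral_deriv_eq_sub]
  refine intervalIntegral.integral_congr_ae ?_
  filter_upwards [hae, ae_eq_zero_of_level hae ε, ae_eq_zero_of_level hae (-ε)]
    with s hs hs₁ hs₂ hsd
  rw [uIoc_of_le hd] at hsd
  replace hsd := Ioc_subset_Icc_self hsd
  specialize hs hsd
  rcases lt_trichotomy |F s| ε with h | h | h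
  · rw [indicator_of_mem (by exact h)]
    refine (hs.congr_of_eventuallyEq ?_).deriv
    filter_upwards [hs.continuousAt.abs.eventually_lt continuousAt_const h] with t ht
    exact clamp_of_abs_le ht.le
  · rw [indicator_of_notMem (fun h' => h'.ne h)]
    have h0 : G s = 0 := by
      rcases abs_choice (F s) with h' | h'
      · exact hs₁ hsd (h' ▸ h)
      · exact hs₂ hsd (by linarith)
    rw [h0] at hs
    exact (hasDerivAt_zero_comp (lipschitzWith_clamp ε) hs).deriv
  · rw [indicator_of_notMem (fun h' => h'.not_gt h)]
    rcases lt_abs.1 h with h' | h'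
    · refine ((hasDerivAt_const s (max (-ε) ε)).congr_of_eventuallyEq ?_).deriv
      filter_upwards [continuousAt_const.eventually_lt hs.continuousAt h'] with t ht
      rw [clamp, min_eq_right ht.le]
    · refine ((hasDerivAt_const s (-ε)).congr_of_eventuallyEq ?_).deriv
      filter_upwards [continuousAt_const.eventually_lt hs.continuousAt.neg h'] with t ht
      exact max_eq_left ((min_le_left _ _).trans (by linarith [show ε < -F t from ht]))

end RealLine

/-! ### The gradient of a truncated function -/

section Truncation

variable {T : Type*} [MetricSpace T] [IsRealTree T] [MeasurableSpace T] [BorelSpace T]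

theorem IsGradient.ae_hasDerivAt_curve {ρ : T} {f g : T → ℝ} (h : IsGradient ρ f g) (y : T) :
    ∀ᵐ s, s ∈ Icc (0 : ℝ) (dist ρ y) →
      HasDerivAt (fun t => f ρ + ∫ r in (0)..t, g (curve ρ y r)) (g (curve ρ y s)) s :=
  ae_hasDerivAt_add_integral dist_nonneg
    ((integrableOn_arc_iff h.aestronglyMeasurable ρ y).1 (h.integrableOn_arc ρ y)) (f ρ)

theorem IsGradient.ae_eq_zero_of_eq_zero [LocallyCompactSpace T] {ρ : T} {f g : T → ℝ}
    (h : IsGradient ρ f g) : ∀ᵐ z ∂lengthMeasure T, f z = 0 → g z = 0 := by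
  refine ae_lengthMeasure_of_ae_curve ρ fun y => ?_
  filter_upwards [ae_eq_zero_of_level (h.ae_hasDerivAt_curve y) 0] with s hs hsd h0
  exact hs hsd (h.apply_curve y hsd ▸ h0)

theorem IsGradient.clamp {ρ : T} {f g : T → ℝ} (h : IsGradient ρ f g) (hf : Continuous f) (ε : ℝ) :
    IsGradient ρ (fun z => clamp ε (f z)) ({z | |f z| < ε}.indicator g) := by
  have hS : MeasurableSet {z | |f z| < ε} := (isOpen_lt hf.abs continuous_const).measurableSet
  have hm := h.aestronglyMeasurable.indicator hS
  rw [isGradient_iff]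
  refine ⟨hm, fun x => (h.integrableOn_arc ρ x).indicator hS, fun x => ?_⟩
  have hi := (integrableOn_arc_iff h.aestronglyMeasurable ρ x).1 (h.integrableOn_arc ρ x)
  have key := clamp_add_integral dist_nonneg hi (f ρ) ε fun t => rfl
  have h0 := h.apply_curve x (left_mem_Icc.2 dist_nonneg)
  have h1 := h.apply_curve x (right_mem_Icc.2 dist_nonneg)
  rw [curve_zero] at h0
  rw [curve_dist] at h1
  rw [← h0, ← h1] at key
  rw [key, setIntegral_arc hm]
  refine intervalIntegral.integral_congr fun s hs => ?_
  rw [uIcc_of_le dist_nonneg] at hs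
  simp only [indicator, mem_ofPred_eq, h.apply_curve x hs]

end Truncation

/-! ### Density for the form norm -/

section Domain

variable {T : Type*} [MetricSpace T] [IsRealTree T] [MeasurableSpace T] [BorelSpace T]

theorem LocallyAbsolutelyContinuous.of_abs_sub_le {f g : T → ℝ}
    (hf : LocallyAbsolutelyContinuous f) (hg : Continuous g) {C : ℝ} (hC : 0 < C)
    (h : ∀ x y, |g x - g y| ≤ C * |f x - f y|) : LocallyAbsolutelyContinuous g := by
  refine ⟨hg, fun ε hε S hS => ?_⟩
  obtain ⟨δ, hδ, hfδ⟩ := hf.2 (ε / C) (div_pos hε hC) S hS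
  refine ⟨δ, hδ, fun n x y hxy hd hs => ?_⟩
  calc ∑ i, |g (x i) - g (y i)| ≤ ∑ i, C * |f (x i) - f (y i)| :=
        Finset.sum_le_sum fun i _ => h _ _
    _ = C * ∑ i, |f (x i) - f (y i)| := by rw [Finset.mul_sum]
    _ < C * (ε / C) := mul_lt_mul_of_pos_left (hfδ n x y hxy hd hs) hC
    _ = ε := mul_div_cancel₀ ε hC.ne'

theorem locallyAbsolutelyContinuous_of_lipschitzWith {f : T → ℝ} {L : NNReal}
    (hf : LipschitzWith L f) : LocallyAbsolutelyContinuous f := by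
  refine ⟨hf.continuous, fun ε hε S _ => ⟨ε / (L + 1), by positivity, fun n x y _ _ hs => ?_⟩⟩
  have hL : (0 : ℝ) < L + 1 := by positivity
  calc ∑ i, |f (x i) - f (y i)| ≤ ∑ i, (L + 1) * dist (x i) (y i) :=
        Finset.sum_le_sum fun i _ => (hf.dist_le_mul _ _).trans
          (mul_le_mul_of_nonneg_right (by linarith) dist_nonneg)
    _ = (L + 1) * ∑ i, dist (x i) (y i) := by rw [Finset.mul_sum]
    _ < (L + 1) * (ε / (L + 1)) := mul_lt_mul_of_pos_left hs hL
    _ = ε := mul_div_cancel₀ ε hL.ne'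

theorem isGradient_gradient {ρ : T} {f : T → ℝ} (h : ∃ g, IsGradient ρ f g) :
    IsGradient ρ f (gradient ρ f) := by
  rw [gradient, dif_pos h]
  exact h.choose_spec

variable [LocallyCompactSpace T]

theorem mem_energySpace {ρ : T} {f g : T → ℝ} (hf : LocallyAbsolutelyContinuous f)
    (h : IsGradient ρ f g) (hg : MemLp g 2 (lengthMeasure T)) : f ∈ energySpace ρ :=
  ⟨hf, ⟨g, h⟩, (memLp_congr_ae (gradient_ae_eq h)).2 hg⟩

theorem energy_self_eq {ρ : T} {f g : T → ℝ} (h : IsGradient ρ f g) :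
    energy ρ f f = (1 / 2) * ∫ z, g z ^ 2 ∂lengthMeasure T := by
  rw [energy]
  congr 1
  refine integral_congr_ae ?_
  filter_upwards [gradient_ae_eq h] with z hz
  rw [hz, sq]

/-- Moving the values of `f` towards zero by `ε` gives compact support, as `f` vanishes at infinity,
and increases neither `|f|` nor the gradient. -/
theorem sub_clamp_mem_domain {ρ : T} {ν : Measure T} {f : T → ℝ} (hf : f ∈ domain ρ ν) {ε : ℝ}
    (hε : 0 < ε) : (fun z => f z - clamp ε (f z)) ∈ domain ρ ν ∩ compactlySupported T := by
  obtain ⟨⟨⟨hac, hex, hL2⟩, hν⟩, hc, h0⟩ := hf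
  have hcont : Continuous fun z => f z - clamp ε (f z) :=
    hc.sub ((lipschitzWith_clamp ε).continuous.comp hc)
  have hgrad := isGradient_gradient hex
  have hS : MeasurableSet {z | |f z| < ε} := (isOpen_lt hc.abs continuous_const).measurableSet
  refine ⟨⟨⟨mem_energySpace ?_ (hgrad.sub (hgrad.clamp hc ε)) ?_, ?_⟩, hcont, ?_⟩, hcont, ?_⟩
  · exact hac.of_abs_sub_le hcont two_pos fun x y => abs_sub_clamp_sub_le ε (f x) (f y)
  · exact hL2.sub (hL2.indicator hS)
  · exact hν.mono hcont.aestronglyMeasurable (.of_forall fun z => abs_sub_clamp_le_abs hε.le (f z))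
  · exact squeeze_zero_norm (fun z => abs_sub_clamp_le_abs hε.le (f z)) (by simpa using h0.abs)
  · have hlt : ∀ᶠ z in cocompact T, |f z| < ε := by
      simpa using h0.abs.eventually_lt_const (by simpa using hε)
    obtain ⟨K, hK, hKf⟩ := mem_cocompact.1 hlt
    exact HasCompactSupport.intro hK fun z hz =>
      sub_eq_zero.2 (clamp_of_abs_le (le_of_lt (hKf hz))).symm

/-- Truncating a function of finite energy at levels tending to zero gives functions that tend to
zero in the form norm: in the limit only the gradient on the zero set remains, and it vanishes. -/
theorem tendsto_energyAlpha_clamp {ρ : T} {ν : Measure T} {f : T → ℝ} (hf : f ∈ domain ρ ν) :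
    Tendsto (fun ε : ℝ => energyAlpha ρ ν 1 (fun z => clamp ε (f z)) (fun z => clamp ε (f z)))
      (𝓝[>] 0) (𝓝 0) := by
  obtain ⟨⟨⟨hac, hex, hL2⟩, hν⟩, hc, h0⟩ := hf
  have hgrad := isGradient_gradient hex
  have hS : ∀ ε : ℝ, MeasurableSet {z | |f z| < ε} := fun ε =>
    (isOpen_lt hc.abs continuous_const).measurableSet
  have hE : Tendsto (fun ε : ℝ => ∫ z, ({z | |f z| < ε}.indicator (gradient ρ f) z) ^ 2
      ∂lengthMeasure T) (𝓝[>] 0) (𝓝 (∫ _, 0 ∂lengthMeasure T)) := by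
    refine tendsto_integral_filter_of_dominated_convergence (fun z => gradient ρ f z ^ 2)
      (.of_forall fun ε => (hL2.1.indicator (hS ε)).pow 2)
      (.of_forall fun ε => .of_forall fun z => ?_) hL2.integrable_sq ?_
    · rw [norm_pow, Real.norm_eq_abs, sq_abs]
      by_cases hz : z ∈ {z | |f z| < ε}
      · rw [indicator_of_mem hz]
      · rw [indicator_of_notMem hz]
        simpa using sq_nonneg (gradient ρ f z)
    · filter_upwards [hgrad.ae_eq_zero_of_eq_zero] with z hz
      refine tendsto_const_nhds.congr' ?_
      by_cases hfz : f z = 0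
      · simp [indicator, hz hfz]
      · filter_upwards [Ioo_mem_nhdsGT (abs_pos.2 hfz)] with ε hε
        rw [indicator_of_notMem (show z ∉ {z | |f z| < ε} from fun h => lt_asymm hε.2 h)]
        simp
  have hN : Tendsto (fun ε : ℝ => ∫ z, clamp ε (f z) * clamp ε (f z) ∂ν) (𝓝[>] 0)
      (𝓝 (∫ _, 0 ∂ν)) := by
    refine tendsto_integral_filter_of_dominated_convergence (fun z => f z ^ 2)
      (.of_forall fun ε => ?_) ?_ hν.integrable_sq (.of_forall fun z => ?_)
    · have := (lipschitzWith_clamp ε).continuous.comp hc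
      exact (this.mul this).aestronglyMeasurable
    · filter_upwards [self_mem_nhdsWithin] with ε hε
      refine .of_forall fun z => ?_
      rw [← sq, norm_pow, Real.norm_eq_abs, ← sq_abs (f z)]
      exact pow_le_pow_left₀ (abs_nonneg _) (abs_clamp_le_abs (le_of_lt hε) _) 2
    · have h1 : Tendsto (fun ε : ℝ => clamp ε (f z)) (𝓝[>] 0) (𝓝 0) := by
        refine squeeze_zero_norm' ?_ (tendsto_nhdsWithin_of_tendsto_nhds tendsto_id)
        filter_upwards [self_mem_nhdsWithin] with ε hε using abs_clamp_le (le_of_lt hε) _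
      simpa using h1.mul h1
  rw [integral_zero] at hE hN
  have := (hE.const_mul (1 / 2)).add (hN.const_mul 1)
  rw [mul_zero, mul_zero, add_zero] at this
  refine this.congr fun ε => ?_
  rw [energyAlpha, energy_self_eq (hgrad.clamp hc ε)]

/-- Compactly supported functions are dense in the domain for the form norm. -/
theorem exists_energyAlpha_sub_lt {ρ : T} {ν : Measure T} {f : T → ℝ} (hf : f ∈ domain ρ ν)
    {ε : ℝ} (hε : 0 < ε) :
    ∃ g ∈ domain ρ ν ∩ compactlySupported T, energyAlpha ρ ν 1 (f - g) (f - g) < ε := by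
  obtain ⟨δ, hlt, hδ⟩ := (((tendsto_energyAlpha_clamp hf).eventually_lt_const hε).and
    self_mem_nhdsWithin).exists
  refine ⟨_, sub_clamp_mem_domain hf hδ, ?_⟩
  have h : (f - fun z => f z - clamp δ (f z)) = fun z => clamp δ (f z) :=
    funext fun z => sub_sub_cancel _ _
  rwa [h]

end Domain

/-! ### Uniform approximation by Lipschitz functions -/

section LipschitzApproximation

variable {X : Type*} [MetricSpace X]

theorem exists_lipschitzWith_abs_sub_le {f : X → ℝ} (hf : Continuous f) (hc : HasCompactSupport f)
    {ε : ℝ} (hε : 0 < ε) :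
    ∃ (L : NNReal) (h : X → ℝ), LipschitzWith L h ∧ ∀ x, |f x - h x| ≤ ε := by
  obtain ⟨M, hM⟩ := hc.exists_bound_of_continuous hf
  obtain ⟨δ, hδ, hfδ⟩ := Metric.uniformContinuous_iff.1
    (hc.uniformContinuous_of_continuous hf) ε hε
  have hM' : ∀ x, -M ≤ f x ∧ f x ≤ M := fun x => abs_le.1 (hM x)
  rcases isEmpty_or_nonempty X with hX | ⟨⟨x₀⟩⟩
  · exact ⟨0, f, .of_dist_le_mul fun x => isEmptyElim x, fun x => isEmptyElim x⟩
  have hM0 : 0 ≤ M := (norm_nonneg _).trans (hM x₀)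
  have hne : Nonempty X := ⟨x₀⟩
  -- The slope `2 * M / δ` makes points at distance at least `δ` irrelevant for the infimum.
  set L : NNReal := ⟨2 * M / δ, by positivity⟩
  have hLδ : (L : ℝ) * δ = 2 * M := div_mul_cancel₀ _ hδ.ne'
  have hbdd : ∀ x, BddBelow (range fun y => f y + L * dist x y) := fun x =>
    ⟨-M, by
      rintro _ ⟨y, rfl⟩
      have : 0 ≤ L * dist x y := by positivity
      linarith [(hM' y).1]⟩
  refine ⟨L, fun x => ⨅ y, (f y + L * dist x y), .of_le_add_mul L fun x y => ?_, fun x => ?_⟩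
  · rw [← sub_le_iff_le_add]
    refine le_ciInf fun w => ?_
    have h1 := ciInf_le (hbdd x) w
    have h2 := mul_le_mul_of_nonneg_left (dist_triangle x y w) L.2
    simp only [NNReal.val_eq_coe] at h2
    linarith
  · have h1 := ciInf_le (hbdd x) x
    rw [dist_self, mul_zero, add_zero] at h1
    have h2 : f x - ε ≤ ⨅ y, (f y + L * dist x y) := by
      refine le_ciInf fun y => ?_
      rcases lt_or_ge (dist x y) δ with h | h
      · have h3 := (abs_lt.1 (hfδ h)).2
        have : 0 ≤ L * dist x y := by positivity
        linarith
      · have h3 := mul_le_mul_of_nonneg_left h L.2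
        simp only [NNReal.val_eq_coe] at h3
        linarith [(hM' x).2, (hM' y).1]
    rw [abs_le]
    constructor <;> linarith

/-- Compactly supported continuous functions are uniform limits of Lipschitz functions with compact
support: take an infimal convolution and move it towards zero to restore compact support. -/
theorem exists_lipschitzWith_hasCompactSupport {f : X → ℝ} (hf : Continuous f)
    (hc : HasCompactSupport f) {ε : ℝ} (hε : 0 < ε) :
    ∃ (L : NNReal) (h : X → ℝ), LipschitzWith L h ∧ HasCompactSupport h ∧ ∀ x, |f x - h x| < ε := by
  obtain ⟨L, h, hL, hfh⟩ := exists_lipschitzWith_abs_sub_le hf hc (show 0 < ε / 3 by linarith)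
  refine ⟨2 * L, fun x => h x - clamp (ε / 3) (h x), .of_dist_le_mul fun x y => ?_, ?_, fun x => ?_⟩
  · have h1 := abs_sub_clamp_sub_le (ε / 3) (h x) (h y)
    have h2 := hL.dist_le_mul x y
    rw [Real.dist_eq] at *
    push_cast
    linarith
  · refine hc.mono (Function.support_subset_iff'.2 fun x hx => ?_)
    have := hfh x
    rw [Function.notMem_support.1 hx, zero_sub, abs_neg] at this
    rw [clamp_of_abs_le this, sub_self]
  · have h1 := abs_clamp_le (show 0 ≤ ε / 3 by linarith) (h x)
    have h2 := abs_add_le (f x - h x) (clamp (ε / 3) (h x))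
    have h3 := hfh x
    rw [show f x - (h x - clamp (ε / 3) (h x)) = f x - h x + clamp (ε / 3) (h x) by ring]
    linarith

end LipschitzApproximation

/-! ### Gradients of Lipschitz functions -/

section RootDerivative

variable {T : Type*} [MetricSpace T] [IsRealTree T]

/-- The left derivative of `f` at `z` along the geodesic from the root `ρ` to `z` (and `0` if this
derivative does not exist). -/
noncomputable def rootDeriv (ρ : T) (f : T → ℝ) (z : T) : ℝ :=
  derivWithin (fun s => f (curve ρ z s)) (Iic (dist ρ z)) (dist ρ z)

theorem rootDeriv_curve {ρ y : T} {f : T → ℝ} {s : ℝ} (hs : s ∈ Icc (0 : ℝ) (dist ρ y))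
    (hf : DifferentiableAt ℝ (fun t => f (curve ρ y t)) s) :
    rootDeriv ρ f (curve ρ y s) = deriv (fun t => f (curve ρ y t)) s := by
  have hd := dist_left_curve ρ y hs
  have heq : ∀ t ≤ s, f (curve ρ (curve ρ y s) t) = f (curve ρ y t) := fun t ht => by
    rw [curve_eq_of_mem_arc (curve_mem_arc ρ y s) (hd.symm ▸ ht)]
  rw [rootDeriv, hd, derivWithin_congr (s := Iic s) heq (heq s le_rfl),
    hf.derivWithin (uniqueDiffWithinAt_Iic s)]

theorem ae_rootDeriv_curve {ρ : T} {f : T → ℝ} {L : NNReal} (hf : LipschitzWith L f) (y : T) :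
    ∀ᵐ s, s ∈ Icc (0 : ℝ) (dist ρ y) →
      rootDeriv ρ f (curve ρ y s) = deriv (fun t => f (curve ρ y t)) s := by
  filter_upwards [(hf.comp (lipschitzWith_curve ρ y)).ae_differentiableAt_real] with s hs hsd
  exact rootDeriv_curve hsd hs

variable [MeasurableSpace T] [BorelSpace T]

theorem IsGradient.lipschitzWith {ρ : T} {f g : T → ℝ} {L : NNReal} (h : IsGradient ρ f g)
    (hg : ∀ᵐ z ∂lengthMeasure T, ‖g z‖ ≤ L) : LipschitzWith L f := by
  have hb : ∀ a b : T, ‖∫ z in arc a b, g z ∂lengthMeasure T‖ ≤ L * dist a b := by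
    intro a b
    have := norm_setIntegral_le_of_norm_le_const_ae (C := L) (μ := lengthMeasure T) (s := arc a b)
      (by rw [lengthMeasure_arc]; exact ENNReal.ofReal_lt_top) (ae_restrict_of_ae hg)
    rwa [Measure.real, lengthMeasure_arc, ENNReal.toReal_ofReal dist_nonneg] at this
  refine .of_dist_le_mul fun x y => ?_
  have h1 := hb (branchPoint ρ x y) x
  have h2 := hb (branchPoint ρ x y) y
  have h3 := mem_arc_iff.1 (branchPoint_mem_arc ρ x y)
  rw [dist_comm x] at h3
  rw [dist_comm (f x), Real.dist_eq, h.sub_eq x y, orientedIntegral, ← h3, mul_add]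
  rw [Real.norm_eq_abs] at h1 h2
  refine (abs_add_le _ _).trans ?_
  rw [abs_neg]
  exact add_le_add h1 h2

variable [LocallyCompactSpace T]

theorem ae_abs_rootDeriv_le (ρ : T) {f : T → ℝ} {L : NNReal} (hf : LipschitzWith L f) :
    ∀ᵐ z ∂lengthMeasure T, ‖rootDeriv ρ f z‖ ≤ L := by
  refine ae_lengthMeasure_of_ae_curve ρ fun y => ?_
  filter_upwards [ae_rootDeriv_curve hf y] with s hs hsd
  rw [hs hsd]
  simpa [Function.comp_def] using
    norm_deriv_le_of_lipschitz (hf.comp (lipschitzWith_curve ρ y)) (x₀ := s)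

theorem aestronglyMeasurable_rootDeriv (ρ : T) {f : T → ℝ} {L : NNReal} (hf : LipschitzWith L f) :
    AEStronglyMeasurable (rootDeriv ρ f) (lengthMeasure T) := by
  obtain ⟨u, hu⟩ := exists_seq_skeleton_subset ρ
  rw [← lengthMeasure_restrict_iUnion_arc hu, aestronglyMeasurable_iUnion_iff]
  intro n
  refine ⟨fun z => deriv (fun t => f (curve ρ (u n) t)) (dist ρ z),
    (stronglyMeasurable_deriv _).comp_measurable (by fun_prop), ?_⟩
  refine (ae_restrict_arc_iff ρ (u n)).2 ?_
  filter_upwards [ae_rootDeriv_curve hf (u n)] with s hs hsd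
  rw [hs hsd, dist_left_curve ρ (u n) hsd]

/-- A Lipschitz function has a gradient, by the fundamental theorem of calculus along geodesics
issuing from the root. -/
theorem isGradient_rootDeriv (ρ : T) {f : T → ℝ} {L : NNReal} (hf : LipschitzWith L f) :
    IsGradient ρ f (rootDeriv ρ f) := by
  have hm := aestronglyMeasurable_rootDeriv ρ hf
  refine isGradient_iff.2 ⟨hm, fun x => ?_, fun x => ?_⟩
  · refine Measure.integrableOn_of_bounded ?_ hm (ae_restrict_of_ae (ae_abs_rootDeriv_le ρ hf))
    rw [lengthMeasure_arc]
    exact ENNReal.ofReal_ne_top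
  · have hac : AbsolutelyContinuousOnInterval (fun t => f (curve ρ x t)) 0 (dist ρ x) :=
      (hf.comp (lipschitzWith_curve ρ x)).lipschitzOnWith.absolutelyContinuousOnInterval
    have h := hac.integral_deriv_eq_sub
    rw [curve_zero, curve_dist] at h
    rw [setIntegral_arc hm, ← h]
    refine intervalIntegral.integral_congr_ae ?_
    filter_upwards [ae_rootDeriv_curve hf x] with s hs hsd
    rw [uIoc_of_le dist_nonneg] at hsd
    exact (hs (Ioc_subset_Icc_self hsd)).symm

end RootDerivative

/-! ### Projection to finitely spanned subtrees -/

section FiniteSubtree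

variable {T : Type*} [MetricSpace T] [IsRealTree T]

/-- The subtree spanned by the root `ρ` and the points of `Y`, as the union of the arcs from `ρ` to
the points of `Y` (so it is empty, and does not contain `ρ`, if `Y` is empty). -/
def subtree (ρ : T) (Y : Set T) : Set T := ⋃ y ∈ Y, arc ρ y

theorem isCompact_subtree (ρ : T) {Y : Set T} (hY : Y.Finite) : IsCompact (subtree ρ Y) :=
  hY.isCompact_biUnion fun y _ => isCompact_arc ρ y

/-- The projection of `x` to a finitely spanned subtree, as the point where the geodesic from the
root to `x` leaves the subtree. -/
theorem exists_arc_inter_subtree (ρ : T) {Y : Set T} (hY : Y.Finite) (hne : Y.Nonempty) (x : T) :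
    ∃ p ∈ arc ρ x, arc ρ x ∩ subtree ρ Y = arc ρ p := by
  obtain ⟨y₀, hy₀⟩ := hne
  obtain ⟨p, ⟨hpx, hpS⟩, hp⟩ := ((isCompact_arc ρ x).inter
    (isCompact_subtree ρ hY)).exists_isMaxOn
    ⟨ρ, left_mem_arc ρ x, mem_iUnion₂.2 ⟨y₀, hy₀, left_mem_arc ρ y₀⟩⟩
    (continuous_const.dist continuous_id : Continuous fun z : T => dist ρ z).continuousOn
  obtain ⟨y, hy, hpy⟩ := mem_iUnion₂.1 hpS
  refine ⟨p, hpx, Subset.antisymm (fun w hw => ?_) (subset_inter (arc_subset_left hpx) ?_)⟩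
  · exact (mem_arc_iff_of_mem_arc hpx w).2 ⟨hw.1, hp hw⟩
  · exact (arc_subset_left hpy).trans (subset_biUnion_of_mem (u := fun y => arc ρ y) hy)

/-- The projection of `z` to a spanned subtree is at least as close to `z` as any spanning point. -/
theorem dist_le_of_arc_inter_subtree {ρ p y z : T} {Y : Set T} (hp : p ∈ arc ρ z)
    (h : arc ρ z ∩ subtree ρ Y = arc ρ p) (hy : y ∈ Y) : dist p z ≤ dist z y := by
  have hz := branchPoint_mem_left ρ z y
  have hc : branchPoint ρ z y ∈ arc ρ p :=
    h ▸ ⟨hz, mem_iUnion₂.2 ⟨y, hy, branchPoint_mem_right ρ z y⟩⟩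
  have h1 := mem_arc_iff.1 hp
  have h2 := mem_arc_iff.1 hc
  have h3 := mem_arc_iff.1 hz
  have h4 := mem_arc_iff.1 (branchPoint_mem_arc ρ z y)
  have h5 := dist_comm z (branchPoint ρ z y)
  linarith [dist_nonneg (x := branchPoint ρ z y) (y := p),
    dist_nonneg (x := branchPoint ρ z y) (y := y)]

variable [MeasurableSpace T] [BorelSpace T]

theorem lengthMeasure_subtree_lt_top (ρ : T) {Y : Set T} (hY : Y.Finite) :
    lengthMeasure T (subtree ρ Y) < ⊤ :=
  measure_biUnion_lt_top hY fun y _ => by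
    rw [lengthMeasure_arc]
    exact ENNReal.ofReal_lt_top

/-- Cutting off the gradient outside a subtree amounts to composing with the projection to it. -/
theorem IsGradient.comp_projection {ρ : T} {f g : T → ℝ} (h : IsGradient ρ f g) {Y : Set T}
    (hY : Y.Finite) {P : T → T} (hP : ∀ x, arc ρ x ∩ subtree ρ Y = arc ρ (P x)) :
    IsGradient ρ (fun x => f (P x)) ((subtree ρ Y).indicator g) := by
  have hS := (isCompact_subtree ρ hY).isClosed.measurableSet
  rw [isGradient_iff] at *
  have hρ : P ρ = ρ := by
    have := hP ρ ▸ right_mem_arc ρ (P ρ)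
    rw [arc_self] at this
    exact this.1
  refine ⟨h.1.indicator hS, fun x => (h.2.1 x).indicator hS, fun x => ?_⟩
  simp only [hρ]
  rw [setIntegral_indicator hS, hP, h.2.2]

variable [LocallyCompactSpace T]

/-- A Lipschitz function with compact support is uniformly close to its composition with the
projection to a subtree spanned by a sufficiently fine finite net. The composition has finite
energy, since its gradient is bounded and lives on a set of finite length. -/
theorem exists_mem_domain_abs_sub_lt (ρ : T) (ν : Measure T) [IsFiniteMeasureOnCompacts ν]
    {f : T → ℝ} {L : NNReal} (hf : LipschitzWith L f) (hc : HasCompactSupport f) {ε : ℝ}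
    (hε : 0 < ε) : ∃ g ∈ domain ρ ν ∩ compactlySupported T, ∀ x, |f x - g x| < ε := by
  obtain ⟨δ, hδ, hK⟩ := hc.isCompact.exists_isCompact_cthickening
  set K := Metric.cthickening δ (tsupport f)
  obtain ⟨η, hη, hηδ, hηε⟩ : ∃ η : ℝ, 0 < η ∧ η < δ / 2 ∧ L * η < ε := by
    refine ⟨min (δ / 4) (ε / (L + 1)), by positivity, ?_, ?_⟩
    · exact (min_le_left _ _).trans_lt (by linarith)
    · calc L * min (δ / 4) (ε / (L + 1)) < (L + 1) * min (δ / 4) (ε / (L + 1)) :=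
            mul_lt_mul_of_pos_right (by linarith) (by positivity)
        _ ≤ (L + 1) * (ε / (L + 1)) := by gcongr; exact min_le_right _ _
        _ = ε := mul_div_cancel₀ ε (by positivity)
  obtain ⟨t, -, htf, ht⟩ := hK.finite_cover_balls hη
  have hY := htf.insert ρ
  choose P hPmem hP using fun x => exists_arc_inter_subtree ρ hY (insert_nonempty ρ t) x
  have hclose : ∀ z ∈ K, dist (P z) z < η := by
    intro z hz
    obtain ⟨y, hy, hzy⟩ := mem_iUnion₂.1 (ht hz)
    exact (dist_le_of_arc_inter_subtree (hPmem z) (hP z) (mem_insert_of_mem ρ hy)).trans_lt hzy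
  -- The geodesic from `P x` to a point `x` outside `K` contains a point of `K` at distance `δ / 2`
  -- from `P x` if `f (P x) ≠ 0`, and this point also has projection `P x`.
  have hout : ∀ x ∉ K, f (P x) = 0 := by
    intro x hx
    by_contra hne
    have hPK : P x ∈ tsupport f := subset_tsupport f hne
    have hlt : δ < dist (P x) x := by
      by_contra hle
      exact hx (Metric.mem_cthickening_of_dist_le x (P x) δ _ hPK
        (by rw [dist_comm]; exact not_lt.1 hle))
    have hm : δ / 2 ∈ Icc (0 : ℝ) (dist (P x) x) := ⟨by linarith, by linarith⟩
    have hd := dist_left_curve (P x) x hm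
    have hzx : curve (P x) x (δ / 2) ∈ arc (P x) x := curve_mem_arc _ _ _
    set z := curve (P x) x (δ / 2)
    have hzK : z ∈ K := Metric.mem_cthickening_of_dist_le z (P x) δ _ hPK
      (by rw [dist_comm, hd]; linarith)
    have hzρ := arc_subset_right (hPmem x) hzx
    have hPz : P z ∈ arc ρ (P x) := by
      have h := (hP z).symm ▸ right_mem_arc ρ (P z)
      rw [← hP x]
      exact ⟨arc_subset_left hzρ h.1, h.2⟩
    have h1 := mem_arc_iff.1 (hPmem x)
    have h2 := mem_arc_iff.1 hzx
    have h3 := mem_arc_iff.1 hzρ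
    have h4 := mem_arc_iff.1 hPz
    have h5 := mem_arc_iff.1 (hPmem z)
    linarith [hclose z hzK, dist_nonneg (x := P z) (y := P x)]
  have hbd := ae_abs_rootDeriv_le ρ hf
  have hS := (isCompact_subtree ρ hY).isClosed.measurableSet
  have hgrad := (isGradient_rootDeriv ρ hf).comp_projection hY hP
  have hlip : LipschitzWith L fun x => f (P x) := hgrad.lipschitzWith <| hbd.mono fun z hz =>
    (norm_indicator_le_norm_self _ _).trans hz
  have hcs : HasCompactSupport fun x => f (P x) := HasCompactSupport.intro hK hout
  refine ⟨fun x => f (P x), ⟨⟨⟨mem_energySpace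
    (locallyAbsolutelyContinuous_of_lipschitzWith hlip) hgrad ?_, ?_⟩, hlip.continuous, ?_⟩,
    hlip.continuous, hcs⟩, fun x => ?_⟩
  · rw [memLp_indicator_iff_restrict hS]
    have : IsFiniteMeasure ((lengthMeasure T).restrict (subtree ρ (insert ρ t))) :=
      isFiniteMeasure_restrict.2 (lengthMeasure_subtree_lt_top ρ hY).ne
    exact MemLp.of_bound (aestronglyMeasurable_rootDeriv ρ hf).restrict L (ae_restrict_of_ae hbd)
  · exact hlip.continuous.memLp_of_hasCompactSupport hcs
  · exact hcs.is_zero_at_infty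
  · by_cases hx : x ∈ K
    · have h1 := hf.dist_le_mul x (P x)
      rw [Real.dist_eq, dist_comm] at h1
      exact h1.trans_lt ((mul_le_mul_of_nonneg_left (hclose x hx).le L.2).trans_lt hηε)
    · have h0 : f x = 0 := image_eq_zero_of_notMem_tsupport fun h =>
        hx (Metric.self_subset_cthickening _ h)
      simpa [h0, hout x hx] using hε

end FiniteSubtree

end RTree

theorem proposition4p1 {T : Type*} [MetricSpace T] [RTree.IsRealTree T] [LocallyCompactSpace T]
    [MeasurableSpace T] [BorelSpace T] (ρ : T) (ν : Measure T)
    [IsFiniteMeasureOnCompacts ν] [ν.IsOpenPosMeasure] :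
    (∀ f ∈ RTree.domain ρ ν, ∀ ε : ℝ, 0 < ε →
      ∃ g ∈ RTree.domain ρ ν ∩ RTree.compactlySupported T,
        RTree.energyAlpha ρ ν 1 (f - g) (f - g) < ε) ∧
    (∀ f ∈ RTree.compactlySupported T, ∀ ε : ℝ, 0 < ε →
      ∃ g ∈ RTree.domain ρ ν ∩ RTree.compactlySupported T, ∀ x : T, |f x - g x| < ε) := by
  refine ⟨fun f hf ε hε => RTree.exists_energyAlpha_sub_lt hf hε, fun f hf ε hε => ?_⟩
  obtain ⟨L, h, hL, hc, hfh⟩ := RTree.exists_lipschitzWith_hasCompactSupport hf.1 hf.2 (half_pos hε)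
  obtain ⟨g, hg, hhg⟩ := RTree.exists_mem_domain_abs_sub_lt ρ ν hL hc (half_pos hε)
  refine ⟨g, hg, fun x => (abs_sub_le (f x) (h x) (g x)).trans_lt ?_⟩
  linarith [hfh x, hhg x]
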